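/- Let $\Lambda$ be the von Mangoldt function ($\Lambda(n)=\ln p$ if $n=p^k$ with $p$ prime and $k\ge 1$ an integer, and $\Lambda(n)=0$ otherwise) and let $\psi(x)=\sum_{n\le x}\Lambda(n)$ be the Chebyshev function. Call a real-valued function $u$, defined for all large real arguments, slowly decreasing (at infinity) if $$\lim_{\lambda\to 1^+}\ \liminf_{x\to+\infty}\bigl(u(\lambda x)-u(x)\bigr)\ \ge\ 0,$$ that is, if this limit exists in $[-\infty,+\infty]$ and is nonnegative. The prime number theorem $\psi(x)\sim x$ $(x\to+\infty)$ holds if and only if the function $x\mapsto\psi(x)/x$ is slowly decreasing. Moreover, the prime number theorem $\psi(x)\sim x$ implies $$\psi(y)-\psi(x)=(y-x)+o(y)\qquad\text{as } y\ge x\to+\infty,$$ that is, for every $\varepsilon>0$ there is $X>0$ such that $|\psi(y)-\psi(x)-(y-x)|\le\varepsilon y$ for all real $y\ge x\ge X$. -/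

import Mathlib

open Filter Topology Asymptotics

/-- A real function `u`, of which only the values at large positive arguments matter, is slowly
decreasing at infinity if the limit, as `lam → 1⁺`, of `liminf_{x → +∞} (u (lam * x) - u x)` exists
and is nonnegative. The lower limit and the limit are taken in `[-∞, +∞]`. -/
def IsSlowlyDecreasing (u : ℝ → ℝ) : Prop :=
  ∃ l : EReal,
    Tendsto (fun lam : ℝ => liminf (fun x : ℝ => ((u (lam * x) - u x : ℝ) : EReal)) atTop)
      (𝓝[>] (1 : ℝ)) (𝓝 l) ∧ 0 ≤ l

/-!
The equivalence holds because the prime number theorem is true: it is proved here as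
`psi_isEquivalent_id`, by a Wiener–Ikehara argument whose Tauberian condition is the monotonicity of
`ψ` (which, with Chebyshev's bound `ψ(x) = O(x)`, already makes `ψ(x) / x` slowly decreasing).
Conversely `ψ(x) / x → 1` makes the differences `ψ(λx) / (λx) - ψ(x) / x` tend to `0` for each
`λ > 1`, so their lower limits vanish.

With `b v = ψ(exp v) * exp (-v)`, which is bounded by Chebyshev's estimate, the Laplace transform of
`b - 1` is `-ζ'/ζ(s + 1) / (s + 1) - 1 / s` on `re s > 0` (`laplace_psi_exp`). Since the zeta
function has no zero on the line `re s = 1` and only a simple pole at `1`, this extends continuously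
to `re s ≥ 0`. Integrating the extension over a segment of the imaginary axis against a tent
function and an oscillating exponential gives the average of `b - 1` against a Fejér kernel centred
at `x` (`integral_tent_mul_boundary`), and the Riemann–Lebesgue lemma makes this average tend to `0`
as `x → ∞` (`tendsto_integral_mul_fejer`). As the kernel may be as concentrated as desired and
`v ↦ b v * exp v` is monotone, it follows that `b v → 1` (`tendsto_one_of_tendsto_kernel_average`).

The statement on increments is `ψ(y) - y = o(y)` minus `ψ(x) - x = o(x)`, where `x ≤ y`.
-/

open MeasureTheory Set

/-! ### The Fejér kernel -/

lemma integral_one_sub_mul_cexp {z : ℂ} (hz : z ≠ 0) :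
    ∫ t in (0 : ℝ)..1, ((1 - t : ℝ) : ℂ) * Complex.exp (z * t) =
      (Complex.exp z - 1 - z) / z ^ 2 := by
  have hderiv : ∀ t ∈ uIcc (0 : ℝ) 1, HasDerivAt
      (fun t : ℝ => ((1 - t : ℂ) / z + 1 / z ^ 2) * Complex.exp (z * t))
      (((1 - t : ℝ) : ℂ) * Complex.exp (z * t)) t := by
    intro t _
    have h1 : HasDerivAt (fun t : ℝ => (t : ℂ)) 1 t := Complex.ofRealCLM.hasDerivAt
    convert! (((h1.const_sub 1).div_const z).add_const (1 / z ^ 2)).mul (h1.const_mul z).cexp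
      using 1
    push_cast
    field_simp
    ring
  rw [intervalIntegral.integral_eq_sub_of_hasDerivAt hderiv
    (Continuous.intervalIntegrable (by fun_prop) _ _)]
  simp only [Complex.ofReal_one, sub_self, zero_div, zero_add, mul_one, Complex.ofReal_zero,
    sub_zero, mul_zero, Complex.exp_zero]
  field_simp
  ring

/-- The Fejér kernel as the Fourier transform of the tent function: the only Fourier-analytic
identity the proof needs, since the kernel enters with compactly supported frequencies. -/
lemma integral_tent_mul_cexp (y : ℝ) :
    ∫ t in (-1 : ℝ)..1, ((1 - |t| : ℝ) : ℂ) * Complex.exp (t * y * Complex.I) =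
      ((Real.sinc (y / 2) ^ 2 : ℝ) : ℂ) := by
  have hcont : Continuous fun t : ℝ =>
      ((1 - |t| : ℝ) : ℂ) * Complex.exp (t * y * Complex.I) := by fun_prop
  have habs : ∀ w : ℂ, ∫ t in (0 : ℝ)..1, ((1 - |t| : ℝ) : ℂ) * Complex.exp (t * w) =
      ∫ t in (0 : ℝ)..1, ((1 - t : ℝ) : ℂ) * Complex.exp (w * t) := by
    intro w
    refine intervalIntegral.integral_congr fun t ht => ?_
    rw [uIcc_of_le zero_le_one] at ht
    simp only [abs_of_nonneg ht.1, mul_comm]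
  have hneg : ∫ t in (-1 : ℝ)..0, ((1 - |t| : ℝ) : ℂ) * Complex.exp (t * y * Complex.I) =
      ∫ t in (0 : ℝ)..1, ((1 - |t| : ℝ) : ℂ) * Complex.exp (t * (-(y * Complex.I))) := by
    have := intervalIntegral.integral_comp_neg (a := 0) (b := 1)
      (fun t : ℝ => ((1 - |t| : ℝ) : ℂ) * Complex.exp (t * y * Complex.I))
    rw [neg_zero] at this
    rw [← this]
    refine intervalIntegral.integral_congr fun t _ => ?_
    simp only [abs_neg]
    congr 2
    push_cast
    ring
  rw [← intervalIntegral.integral_add_adjacent_intervals (b := 0)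
    (hcont.intervalIntegrable _ _) (hcont.intervalIntegrable _ _), hneg]
  simp_rw [mul_assoc]
  rw [habs, habs]
  rcases eq_or_ne y 0 with rfl | hy
  · have : ∫ t in (0 : ℝ)..1, ((1 - t : ℝ) : ℂ) = 1 / 2 := by
      have hr : ∫ t in (0 : ℝ)..1, (1 - t) = 1 / 2 := by
        rw [intervalIntegral.integral_sub (by simp) (by simp)]
        norm_num
      rw [intervalIntegral.integral_ofReal, hr]
      norm_num
    simp only [Complex.ofReal_zero, zero_mul, neg_zero, Complex.exp_zero, mul_one, zero_div,
      Real.sinc_zero, this]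
    norm_num
  · have hz : (y : ℂ) * Complex.I ≠ 0 := by simp [hy]
    rw [integral_one_sub_mul_cexp hz, integral_one_sub_mul_cexp (neg_ne_zero.2 hz),
      Real.sinc_of_ne_zero (by positivity)]
    have hyc : (y : ℂ) ≠ 0 := by exact_mod_cast hy
    have hcos : Complex.exp (y * Complex.I) + Complex.exp (-(y * Complex.I)) =
        2 - 4 * Complex.sin (y / 2) ^ 2 := by
      rw [show -((y : ℂ) * Complex.I) = (-y) * Complex.I by ring, ← Complex.two_cos,
        show (y : ℂ) = 2 * (y / 2) by ring, Complex.cos_two_mul, Complex.cos_sq']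
      ring_nf
    have hI : ((y : ℂ) * Complex.I) ^ 2 = -y ^ 2 := by rw [mul_pow, Complex.I_sq]; ring
    push_cast
    rw [neg_sq, hI]
    field_simp
    linear_combination -hcos

lemma fejer_le (y : ℝ) : Real.sinc (y / 2) ^ 2 ≤ 5 * (1 + y ^ 2)⁻¹ := by
  rw [← div_eq_mul_inv, le_div_iff₀ (by positivity)]
  have h1 : Real.sinc (y / 2) ^ 2 ≤ 1 := by
    rw [sq_le_one_iff_abs_le_one]; exact Real.abs_sinc_le_one _
  have h2 : Real.sinc (y / 2) ^ 2 * y ^ 2 ≤ 4 := by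
    rcases eq_or_ne y 0 with rfl | hy
    · simp
    · rw [Real.sinc_of_ne_zero (by positivity), div_pow, div_pow]
      have := Real.sin_sq_le_one (y / 2)
      field_simp
      linarith
  linarith

lemma continuous_fejer : Continuous fun y : ℝ => Real.sinc (y / 2) ^ 2 := by
  have := Real.continuous_sinc
  fun_prop

lemma integrable_fejer : Integrable fun y : ℝ => Real.sinc (y / 2) ^ 2 := by
  refine (integrable_inv_one_add_sq.const_mul 5).mono'
    continuous_fejer.aestronglyMeasurable (ae_of_all _ fun y => ?_)
  rw [Real.norm_of_nonneg (sq_nonneg _)]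
  exact fejer_le y

lemma integral_fejer_pos : 0 < ∫ y : ℝ, Real.sinc (y / 2) ^ 2 := by
  rw [integral_pos_iff_support_of_nonneg (fun y => sq_nonneg _) integrable_fejer]
  exact (continuous_fejer.isOpen_support).measure_pos _ ⟨0, by simp⟩

lemma integral_fejer_scaled {T : ℝ} (hT : 0 < T) :
    ∫ u : ℝ, Real.sinc (T * u / 2) ^ 2 = T⁻¹ * ∫ y : ℝ, Real.sinc (y / 2) ^ 2 := by
  rw [Measure.integral_comp_mul_left (fun y : ℝ => Real.sinc (y / 2) ^ 2) T,
    abs_of_pos (inv_pos.2 hT), smul_eq_mul]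

lemma integrable_fejer_scaled {T : ℝ} (hT : 0 < T) :
    Integrable fun u : ℝ => Real.sinc (T * u / 2) ^ 2 :=
  integrable_fejer.comp_mul_left' hT.ne'

/-- After normalization the kernels `u ↦ T * sinc (T * u / 2) ^ 2` concentrate at `0`. -/
lemma exists_fejer_tail_le {δ η : ℝ} (hδ : 0 < δ) (hη : 0 < η) :
    ∃ T : ℝ, 0 < T ∧
      T * ∫ u in (Icc (-δ) δ)ᶜ, Real.sinc (T * u / 2) ^ 2 ≤ η := by
  have hlim : Tendsto (fun T : ℝ => ∫ y in (Icc (-(T * δ)) (T * δ))ᶜ, Real.sinc (y / 2) ^ 2)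
      atTop (𝓝 0) := by
    simp_rw [← integral_indicator measurableSet_Icc.compl]
    rw [show (0 : ℝ) = ∫ _ : ℝ, (0 : ℝ) by simp]
    refine tendsto_integral_filter_of_dominated_convergence (fun y => Real.sinc (y / 2) ^ 2)
      (.of_forall fun T => (continuous_fejer.measurable.indicator
        measurableSet_Icc.compl).aestronglyMeasurable)
      (.of_forall fun T => ae_of_all _ fun y => ?_) integrable_fejer
      (ae_of_all _ fun y => ?_)
    · exact (norm_indicator_le_norm_self _ _).trans_eq (Real.norm_of_nonneg (sq_nonneg _))
    · refine tendsto_const_nhds.congr' ?_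
      filter_upwards [(tendsto_id.atTop_mul_const hδ).eventually_ge_atTop |y|] with T hT
      rw [indicator_of_notMem]
      simpa using abs_le.1 hT
  obtain ⟨T, hT, hT0⟩ :=
    ((hlim.eventually (ge_mem_nhds hη)).and (eventually_gt_atTop 0)).exists
  refine ⟨T, hT0, le_trans (le_of_eq ?_) hT⟩
  rw [← integral_indicator measurableSet_Icc.compl, ← integral_indicator measurableSet_Icc.compl]
  have := Measure.integral_comp_mul_left
    ((Icc (-(T * δ)) (T * δ))ᶜ.indicator fun y : ℝ => Real.sinc (y / 2) ^ 2) T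
  rw [abs_of_pos (inv_pos.2 hT0), smul_eq_mul, inv_mul_eq_div, eq_div_iff hT0.ne', mul_comm] at this
  rw [← this]
  congr 2
  ext u
  have hiff : u ∈ (Icc (-δ) δ)ᶜ ↔ T * u ∈ (Icc (-(T * δ)) (T * δ))ᶜ := by
    rw [mem_compl_iff, mem_compl_iff, mem_Icc, mem_Icc, ← mul_neg, mul_le_mul_iff_right₀ hT0,
      mul_le_mul_iff_right₀ hT0]
  by_cases hu : u ∈ (Icc (-δ) δ)ᶜ
  · rw [indicator_of_mem hu, indicator_of_mem (hiff.1 hu)]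
  · rw [indicator_of_notMem hu, indicator_of_notMem (mt hiff.2 hu)]

/-! ### From kernel averages to a limit -/

/-- A lower bound for `b` near `y` bounds its average against a kernel concentrated near `0` from
below, at the cost of the mass of the kernel away from `0`. -/
lemma mul_sub_le_integral_mul_kernel {b k : ℝ → ℝ} {m y δ : ℝ}
    (hb : ∀ v, 0 ≤ b v) (hbm : ∀ v ∈ Icc (y - δ) (y + δ), m ≤ b v)
    (hk : Integrable k) (hk0 : ∀ u, 0 ≤ k u) (hint : Integrable fun v => b v * k (y - v)) :
    m * ((∫ u, k u) - ∫ u in (Icc (-δ) δ)ᶜ, k u) ≤ ∫ v, b v * k (y - v) := by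
  have hkq : Integrable ((Icc (-δ) δ).indicator k) := hk.indicator measurableSet_Icc
  rw [setIntegral_compl measurableSet_Icc hk, sub_sub_cancel,
    ← integral_indicator measurableSet_Icc, ← integral_sub_left_eq_self _ volume y,
    ← integral_const_mul]
  refine integral_mono ((hkq.comp_sub_left y).const_mul m) hint fun v => ?_
  by_cases hv : y - v ∈ Icc (-δ) δ
  · simp only [indicator_of_mem hv]
    exact mul_le_mul_of_nonneg_right
      (hbm v ⟨by linarith [hv.2], by linarith [hv.1]⟩) (hk0 _)
  · simp only [indicator_of_notMem hv, mul_zero]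
    exact mul_nonneg (hb v) (hk0 _)

lemma integral_mul_kernel_le {b k : ℝ → ℝ} {m C y δ : ℝ} (hm : 0 ≤ m)
    (hbC : ∀ v, b v ≤ C) (hbm : ∀ v ∈ Icc (y - δ) (y + δ), b v ≤ m)
    (hk : Integrable k) (hk0 : ∀ u, 0 ≤ k u) (hint : Integrable fun v => b v * k (y - v)) :
    ∫ v, b v * k (y - v) ≤ m * (∫ u, k u) + C * ∫ u in (Icc (-δ) δ)ᶜ, k u := by
  have hkq : Integrable ((Icc (-δ) δ)ᶜ.indicator k) := hk.indicator measurableSet_Icc.compl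
  rw [← integral_indicator measurableSet_Icc.compl, ← integral_sub_left_eq_self k volume y,
    ← integral_sub_left_eq_self ((Icc (-δ) δ)ᶜ.indicator k) volume y,
    ← integral_const_mul, ← integral_const_mul,
    ← integral_add ((hk.comp_sub_left y).const_mul m) ((hkq.comp_sub_left y).const_mul C)]
  refine integral_mono hint
    (((hk.comp_sub_left y).const_mul m).add ((hkq.comp_sub_left y).const_mul C)) fun v => ?_
  by_cases hv : y - v ∈ (Icc (-δ) δ)ᶜ
  · simp only [indicator_of_mem hv]
    have := mul_le_mul_of_nonneg_right (hbC v) (hk0 (y - v))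
    have := mul_nonneg hm (hk0 (y - v))
    linarith
  · simp only [indicator_of_notMem hv, mul_zero, add_zero]
    rw [notMem_compl_iff] at hv
    exact mul_le_mul_of_nonneg_right
      (hbm v ⟨by linarith [hv.2], by linarith [hv.1]⟩) (hk0 _)

/-- If `b` is bounded and `v ↦ b v * exp v` is monotone, then `b v → 1` as soon as the averages of
`b` against arbitrarily concentrated kernels of mass `1` tend to `1`. By monotonicity, `b` changes
by a factor of at most `exp (2 * δ)` on one side of `x` over a distance `2 * δ`: centring the kernel
at `x - δ` bounds `b x` from below, centring it at `x + δ` bounds `b x` from above. -/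
lemma tendsto_one_of_tendsto_kernel_average {b : ℝ → ℝ} {C : ℝ} (hbm : Measurable b)
    (hb0 : ∀ v, 0 ≤ b v) (hbC : ∀ v, b v ≤ C)
    (hmono : ∀ v w, v ≤ w → b v ≤ b w * Real.exp (w - v))
    (hker : ∀ δ > 0, ∀ η > 0, ∃ k : ℝ → ℝ, (∀ u, 0 ≤ k u) ∧ Integrable k ∧ ∫ u, k u = 1 ∧
      ∫ u in (Icc (-δ) δ)ᶜ, k u ≤ η ∧
      Tendsto (fun x => ∫ v, b v * k (x - v)) atTop (𝓝 1)) :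
    Tendsto b atTop (𝓝 1) := by
  have hC : 0 ≤ C := (hb0 0).trans (hbC 0)
  have hint : ∀ k : ℝ → ℝ, Integrable k → ∀ y, Integrable fun v => b v * k (y - v) := by
    intro k hk y
    refine (hk.comp_sub_left y).bdd_mul (c := C) hbm.aestronglyMeasurable (ae_of_all _ fun v => ?_)
    rw [Real.norm_of_nonneg (hb0 v)]
    exact hbC v
  rw [tendsto_order]
  constructor
  · intro l hl
    have hδ : ∀ᶠ δ : ℝ in 𝓝[>] 0, l * Real.exp (2 * δ) < 1 - δ - C * δ := by
      refine (ContinuousAt.eventually_lt (by fun_prop) (by fun_prop) ?_).filter_mono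
        nhdsWithin_le_nhds
      simpa using hl
    obtain ⟨δ, hδ, hδ0 : 0 < δ⟩ := (hδ.and self_mem_nhdsWithin).exists
    obtain ⟨k, hk0, hk, hk1, hkη, hlim⟩ := hker δ hδ0 δ hδ0
    have hlim' := hlim.comp (tendsto_atTop_add_const_right _ (-δ) tendsto_id)
    filter_upwards [hlim'.eventually (lt_mem_nhds (show 1 - δ < 1 by linarith))] with x hx
    have h1 := integral_mul_kernel_le (m := b x * Real.exp (2 * δ)) (y := x + -δ) (δ := δ)
      (mul_nonneg (hb0 x) (Real.exp_pos _).le) hbC (fun v hv => ?_) hk hk0 (hint k hk _)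
    · simp only [Function.comp_apply, id] at hx
      rw [hk1, mul_one] at h1
      have h2 := mul_le_mul_of_nonneg_left hkη hC
      have h3 : l * Real.exp (2 * δ) < b x * Real.exp (2 * δ) := by linarith
      exact lt_of_mul_lt_mul_right h3 (Real.exp_pos _).le
    · refine (hmono v x (by linarith [hv.2])).trans ?_
      gcongr
      · exact hb0 x
      · linarith [hv.1]
  · intro r hr
    have hδ : ∀ᶠ δ : ℝ in 𝓝[>] 0, 1 + δ < r * Real.exp (-(2 * δ)) * (1 - δ) := by
      refine (ContinuousAt.eventually_lt (by fun_prop) (by fun_prop) ?_).filter_mono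
        nhdsWithin_le_nhds
      simpa using hr
    have hδ1 : ∀ᶠ δ : ℝ in 𝓝[>] 0, δ < 1 :=
      nhdsWithin_le_nhds (gt_mem_nhds one_pos)
    obtain ⟨δ, ⟨hδ, hδ1⟩, hδ0 : 0 < δ⟩ := ((hδ.and hδ1).and self_mem_nhdsWithin).exists
    obtain ⟨k, hk0, hk, hk1, hkη, hlim⟩ := hker δ hδ0 δ hδ0
    have hlim' := hlim.comp (tendsto_atTop_add_const_right _ δ tendsto_id)
    filter_upwards [hlim'.eventually (gt_mem_nhds (show 1 < 1 + δ by linarith))] with x hx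
    have h1 := mul_sub_le_integral_mul_kernel (m := b x * Real.exp (-(2 * δ))) (y := x + δ)
      (δ := δ) hb0 (fun v hv => ?_) hk hk0 (hint k hk _)
    · simp only [Function.comp_apply, id] at hx
      rw [hk1] at h1
      have h2 : b x * Real.exp (-(2 * δ)) * (1 - δ) ≤
          b x * Real.exp (-(2 * δ)) * (1 - ∫ u in (Icc (-δ) δ)ᶜ, k u) :=
        mul_le_mul_of_nonneg_left (by linarith) (mul_nonneg (hb0 x) (Real.exp_pos _).le)
      have h3 : b x * (Real.exp (-(2 * δ)) * (1 - δ)) < r * (Real.exp (-(2 * δ)) * (1 - δ)) := by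
        linarith
      exact lt_of_mul_lt_mul_right h3 (mul_nonneg (Real.exp_pos _).le (by linarith))
    · have h4 := hmono x v (by linarith [hv.1])
      calc b x * Real.exp (-(2 * δ)) ≤ b v * Real.exp (v - x) * Real.exp (-(2 * δ)) := by gcongr
        _ = b v * Real.exp (v - x - 2 * δ) := by rw [mul_assoc, ← Real.exp_add]; rfl
        _ ≤ b v * 1 := by
          gcongr
          · exact hb0 v
          · rw [Real.exp_le_one_iff]; linarith [hv.2]
        _ = b v := mul_one _

/-! ### A Wiener–Ikehara theorem -/

/-- Fubini's theorem: integrating the Laplace transform of `f` along a vertical segment of abscissa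
`σ > 0` against the tent function yields an average of `f v * exp (-(σ * v))` against the Fejér
kernel. -/
lemma integral_tent_mul_laplace {f : ℝ → ℝ} {C : ℝ} (hf : Measurable f) (hfC : ∀ v, |f v| ≤ C)
    {σ : ℝ} (hσ : 0 < σ) (T x : ℝ) :
    ∫ t in (-1 : ℝ)..1, ((1 - |t| : ℝ) : ℂ) * Complex.exp (t * (T * x : ℝ) * Complex.I) *
        (∫ v in Ioi (0 : ℝ), (f v : ℂ) * Complex.exp (-((σ + T * t * Complex.I) * v))) =
      ∫ v in Ioi (0 : ℝ),
        ((f v * Real.exp (-(σ * v)) * Real.sinc (T * (x - v) / 2) ^ 2 : ℝ) : ℂ) := by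
  have hC : 0 ≤ C := (abs_nonneg _).trans (hfC 0)
  simp_rw [← integral_const_mul]
  rw [intervalIntegral_integral_swap]
  · refine setIntegral_congr_fun measurableSet_Ioi fun v _ => ?_
    push_cast
    have h := integral_tent_mul_cexp (T * (x - v))
    push_cast at h
    rw [← h, ← intervalIntegral.integral_const_mul]
    refine intervalIntegral.integral_congr fun t _ => ?_
    have hexp : Complex.exp (t * (T * x) * Complex.I) *
        Complex.exp (-((σ + T * t * Complex.I) * v)) =
        Complex.exp (-(σ * v)) * Complex.exp (t * (T * (x - v)) * Complex.I) := by
      rw [← Complex.exp_add, ← Complex.exp_add]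
      congr 1
      ring
    linear_combination (f v : ℂ) * (1 - (|t| : ℝ)) * hexp
  · have hexp : IntegrableOn (fun v : ℝ => Real.exp (-σ * v)) (Ioi 0) :=
      integrableOn_exp_mul_Ioi (by linarith) 0
    have hone : Integrable (fun _ : ℝ => C) (volume.restrict (uIoc (-1 : ℝ) 1)) := by
      simp [uIoc]
    refine (hone.mul_prod hexp).mono' ?_ ?_
    · refine Measurable.aestronglyMeasurable ?_
      simp only [Function.uncurry_def]
      fun_prop
    · rw [Measure.prod_restrict]
      refine (ae_restrict_iff' (measurableSet_uIoc.prod measurableSet_Ioi)).2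
        (ae_of_all _ fun z hz => ?_)
      have hz1 : |1 - (|z.1|)| ≤ 1 := by
        have := hz.1
        rw [uIoc_of_le (by norm_num)] at this
        have h1 : |z.1| ≤ 1 := abs_le.2 ⟨this.1.le, this.2⟩
        rw [abs_le]
        constructor <;> linarith [abs_nonneg z.1]
      simp only [Function.uncurry, norm_mul, Complex.norm_real, Real.norm_eq_abs,
        Complex.norm_exp]
      have e1 : ((z.1 : ℂ) * ((T * x : ℝ) : ℂ) * Complex.I).re = 0 := by
        simp
      have e2 : (-(((σ : ℂ) + T * z.1 * Complex.I) * z.2)).re = -σ * z.2 := by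
        simp
      rw [e1, e2, Real.exp_zero, mul_one, ← one_mul (C * _)]
      gcongr
      exact hfC _

/-- The limit `σ → 0⁺` of `integral_tent_mul_laplace`, for a Laplace transform that extends
continuously to the imaginary axis. -/
lemma integral_tent_mul_boundary {f : ℝ → ℝ} {C : ℝ} (hf : Measurable f) (hfC : ∀ v, |f v| ≤ C)
    {G : ℂ → ℂ} (hG : Continuous G)
    (hlap : ∀ s : ℂ, 0 < s.re →
      G s = ∫ v in Ioi (0 : ℝ), (f v : ℂ) * Complex.exp (-(s * v)))
    {T : ℝ} (hT : 0 < T) (x : ℝ) :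
    ∫ t in (-1 : ℝ)..1, ((1 - |t| : ℝ) : ℂ) * Complex.exp (t * (T * x : ℝ) * Complex.I) *
        G (T * t * Complex.I) =
      ((∫ v in Ioi (0 : ℝ), f v * Real.sinc (T * (x - v) / 2) ^ 2 : ℝ) : ℂ) := by
  have hl : Tendsto (fun σ : ℝ => ∫ t in (-1 : ℝ)..1, ((1 - |t| : ℝ) : ℂ) *
      Complex.exp (t * (T * x : ℝ) * Complex.I) * G (σ + T * t * Complex.I)) (𝓝[>] 0)
      (𝓝 (∫ t in (-1 : ℝ)..1, ((1 - |t| : ℝ) : ℂ) *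
        Complex.exp (t * (T * x : ℝ) * Complex.I) * G (T * t * Complex.I))) := by
    have hc := intervalIntegral.continuous_parametric_intervalIntegral_of_continuous'
      (f := fun σ t : ℝ => ((1 - |t| : ℝ) : ℂ) *
        Complex.exp (t * (T * x : ℝ) * Complex.I) * G (σ + T * t * Complex.I))
      (μ := volume) (by simp only [Function.uncurry_def]; fun_prop) (-1) 1
    have := (hc.tendsto 0).mono_left (nhdsWithin_le_nhds (s := Ioi 0))
    simpa using this
  have hr : Tendsto (fun σ : ℝ => ∫ v in Ioi (0 : ℝ),
      ((f v * Real.exp (-(σ * v)) * Real.sinc (T * (x - v) / 2) ^ 2 : ℝ) : ℂ)) (𝓝[>] 0)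
      (𝓝 (∫ v in Ioi (0 : ℝ), ((f v * Real.sinc (T * (x - v) / 2) ^ 2 : ℝ) : ℂ))) := by
    have hs := Real.continuous_sinc.measurable
    refine tendsto_integral_filter_of_dominated_convergence
      (fun v => C * Real.sinc (T * (x - v) / 2) ^ 2)
      (.of_forall fun σ => Measurable.aestronglyMeasurable (by fun_prop)) ?_
      (((integrable_fejer_scaled hT).comp_sub_left x).const_mul C).restrict
      (ae_of_all _ fun v => ?_)
    · filter_upwards [self_mem_nhdsWithin] with σ hσ
      refine (ae_restrict_iff' measurableSet_Ioi).2 (ae_of_all _ fun v hv => ?_)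
      rw [Complex.norm_real, Real.norm_eq_abs, abs_mul, abs_mul, Real.abs_exp,
        abs_of_nonneg (sq_nonneg (Real.sinc _))]
      have h1 : Real.exp (-(σ * v)) ≤ 1 :=
        Real.exp_le_one_iff.2 (neg_nonpos.2 (mul_nonneg (le_of_lt hσ) (le_of_lt hv)))
      gcongr
      exact (mul_le_of_le_one_right (abs_nonneg _) h1).trans (hfC v)
    · have hc : Continuous fun σ : ℝ =>
          ((f v * Real.exp (-(σ * v)) * Real.sinc (T * (x - v) / 2) ^ 2 : ℝ) : ℂ) := by fun_prop
      simpa using (hc.tendsto 0).mono_left (nhdsWithin_le_nhds (s := Ioi 0))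
  rw [← integral_complex_ofReal]
  refine tendsto_nhds_unique hl (hr.congr' ?_)
  filter_upwards [self_mem_nhdsWithin] with σ hσ
  rw [← integral_tent_mul_laplace hf hfC hσ]
  refine intervalIntegral.integral_congr fun t _ => ?_
  rw [hlap _ (by simpa using hσ)]

/-- By the Riemann–Lebesgue lemma, the averages of `f` against the Fejér kernel centred at `x` tend
to `0` if the Laplace transform of `f` extends continuously to the closed right half-plane. -/
lemma tendsto_integral_mul_fejer {f : ℝ → ℝ} {C : ℝ} (hf : Measurable f) (hfC : ∀ v, |f v| ≤ C)
    {G : ℂ → ℂ} (hG : ContinuousOn G {s | 0 ≤ s.re})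
    (hlap : ∀ s : ℂ, 0 < s.re →
      G s = ∫ v in Ioi (0 : ℝ), (f v : ℂ) * Complex.exp (-(s * v)))
    {T : ℝ} (hT : 0 < T) :
    Tendsto (fun x => ∫ v in Ioi (0 : ℝ), f v * Real.sinc (T * (x - v) / 2) ^ 2) atTop (𝓝 0) := by
  -- Extending `G` to the whole plane, constantly along horizontal half-lines, makes it continuous.
  let G' : ℂ → ℂ := fun s => G ((max s.re 0 : ℝ) + s.im * Complex.I)
  have hG'c : Continuous G' :=
    hG.comp_continuous (by fun_prop) fun s => by simp
  have hlap' : ∀ s : ℂ, 0 < s.re →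
      G' s = ∫ v in Ioi (0 : ℝ), (f v : ℂ) * Complex.exp (-(s * v)) := by
    intro s hs
    simp only [← hlap s hs, G', max_eq_left hs.le, Complex.re_add_im]
  have hbd := fun x => integral_tent_mul_boundary hf hfC hG'c hlap' hT x
  set h : ℝ → ℂ := (Ioc (-1 : ℝ) 1).indicator fun t => ((1 - |t| : ℝ) : ℂ) * G' (T * t * Complex.I)
  have hRL := Real.tendsto_integral_exp_smul_cocompact h
  -- The additive character of Mathlib's Fourier transform is `x ↦ exp (2 * π * I * x)`.
  have hw : Tendsto (fun x : ℝ => -(T * x / (2 * Real.pi))) atTop (cocompact ℝ) := by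
    refine Tendsto.mono_right (tendsto_neg_atTop_atBot.comp ?_) atBot_le_cocompact
    exact (tendsto_id.const_mul_atTop hT).atTop_div_const (by positivity)
  refine tendsto_ofReal_iff.1 ?_
  rw [Complex.ofReal_zero]
  refine (hRL.comp hw).congr fun x => ?_
  refine Eq.trans ?_ (hbd x)
  rw [intervalIntegral.integral_of_le (by norm_num), ← integral_indicator measurableSet_Ioc]
  refine integral_congr_ae (ae_of_all _ fun t => ?_)
  by_cases ht : t ∈ Ioc (-1 : ℝ) 1
  · simp only [h, indicator_of_mem ht, Circle.smul_def, Real.fourierChar_apply, smul_eq_mul]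
    rw [mul_left_comm, ← mul_assoc]
    congr 4
    have : Real.pi ≠ 0 := Real.pi_ne_zero
    field_simp
    push_cast
    ring
  · simp only [h, indicator_of_notMem ht, smul_zero]

/-- **Wiener–Ikehara theorem**, for a bounded function `b` such that `v ↦ b v * exp v` is monotone:
if the Laplace transform of `b - 1` extends continuously to the imaginary axis, then `b v → 1`. -/
theorem tendsto_one_of_laplace_continuousOn {b : ℝ → ℝ} {C : ℝ} (hbm : Measurable b)
    (hb0 : ∀ v, 0 ≤ b v) (hbC : ∀ v, b v ≤ C) (hsupp : ∀ v ≤ 0, b v = 0)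
    (hmono : ∀ v w, v ≤ w → b v ≤ b w * Real.exp (w - v))
    {G : ℂ → ℂ} (hG : ContinuousOn G {s | 0 ≤ s.re})
    (hlap : ∀ s : ℂ, 0 < s.re →
      G s = ∫ v in Ioi (0 : ℝ), ((b v - 1 : ℝ) : ℂ) * Complex.exp (-(s * v))) :
    Tendsto b atTop (𝓝 1) := by
  refine tendsto_one_of_tendsto_kernel_average hbm hb0 hbC hmono fun δ hδ η hη => ?_
  set c := ∫ y : ℝ, Real.sinc (y / 2) ^ 2 with hc
  have hc0 : 0 < c := integral_fejer_pos
  obtain ⟨T, hT, htail⟩ := exists_fejer_tail_le hδ (mul_pos hη hc0)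
  have hF := integrable_fejer_scaled hT
  refine ⟨fun u => T / c * Real.sinc (T * u / 2) ^ 2, fun u => by positivity, hF.const_mul _,
    ?_, ?_, ?_⟩
  · rw [integral_const_mul, integral_fejer_scaled hT, ← hc]
    field_simp
  · rw [integral_const_mul, div_mul_eq_mul_div, div_le_iff₀ hc0]
    exact htail
  · have h1 := tendsto_integral_mul_fejer (f := fun v => b v - 1) (C := C + 1) (by fun_prop)
      (fun v => by rw [abs_le]; constructor <;> linarith [hb0 v, hbC v, (hb0 v).trans (hbC v)])
      hG hlap hT
    have h2 : Tendsto (fun x => ∫ v in Ioi (0 : ℝ), Real.sinc (T * (x - v) / 2) ^ 2) atTop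
        (𝓝 (T⁻¹ * c)) := by
      rw [← integral_fejer_scaled hT]
      have h3 := (aecover_Iio tendsto_id).integral_tendsto_of_countably_generated hF
      refine h3.congr fun x => ?_
      rw [← integral_indicator measurableSet_Iio, ← integral_indicator measurableSet_Ioi,
        ← integral_sub_left_eq_self _ volume x]
      refine integral_congr_ae (ae_of_all _ fun v => ?_)
      simp [indicator]
    have h4 := (h1.add h2).const_mul (T / c)
    rw [zero_add, show T / c * (T⁻¹ * c) = 1 by field_simp] at h4
    refine h4.congr fun x => ?_
    have hFx := hF.comp_sub_left x
    have hbF : Integrable fun v => b v * Real.sinc (T * (x - v) / 2) ^ 2 :=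
      hFx.bdd_mul (c := C) hbm.aestronglyMeasurable
        (ae_of_all _ fun v => by rw [Real.norm_of_nonneg (hb0 v)]; exact hbC v)
    simp_rw [sub_mul, one_mul]
    rw [integral_sub hbF.integrableOn hFx.integrableOn, sub_add_cancel, ← integral_const_mul]
    simp_rw [mul_left_comm]
    refine setIntegral_eq_integral_of_forall_compl_eq_zero fun v hv => ?_
    rw [hsupp v (not_lt.1 hv), zero_mul]

/-! ### The prime number theorem -/

/-- The Dirichlet series of the von Mangoldt function, minus its pole at `1`, extends continuously
to the line `re s = 1`. This is where the non-vanishing of the zeta function on that line enters. -/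
lemma exists_continuousOn_sub_pole_vonMangoldt :
    ∃ H : ℂ → ℂ, ContinuousOn H {s | 1 ≤ s.re} ∧ ∀ s : ℂ, 1 < s.re →
      H s = LSeries (fun n => (ArithmeticFunction.vonMangoldt n : ℂ)) s - 1 / (s - 1) := by
  -- Modulo `1` there is a single residue class, so the statement for residue classes applies.
  refine ⟨_, ArithmeticFunction.vonMangoldt.continuousOn_LFunctionResidueClassAux (q := 1) 1,
    fun s hs => ?_⟩
  rw [ArithmeticFunction.vonMangoldt.eqOn_LFunctionResidueClassAux isUnit_one hs]
  have : ArithmeticFunction.vonMangoldt.residueClass (1 : ZMod 1) =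
      fun n => ArithmeticFunction.vonMangoldt n := by
    ext n
    simp [ArithmeticFunction.vonMangoldt.residueClass, Subsingleton.elim (n : ZMod 1) 1]
  simp [this]

lemma LSeries_vonMangoldt_eq_mul_integral_psi {s : ℂ} (hs : 1 < s.re) :
    LSeries (fun n => (ArithmeticFunction.vonMangoldt n : ℂ)) s =
      s * ∫ t in Ioi (1 : ℝ), (Chebyshev.psi t : ℂ) * (t : ℂ) ^ (-(s + 1)) := by
  have hpsi : ∀ t : ℝ, Chebyshev.psi t =
      ∑ k ∈ Finset.Icc 1 ⌊t⌋₊, ArithmeticFunction.vonMangoldt k := fun t => by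
    rw [Chebyshev.psi, ← Finset.Icc_add_one_left_eq_Ioc, zero_add]
  rw [LSeries_eq_mul_integral_of_nonneg _ zero_le_one hs ?_ fun n =>
    ArithmeticFunction.vonMangoldt_nonneg]
  · simp_rw [hpsi, Complex.ofReal_sum]
  · refine IsBigO.of_bound (Real.log 4 + 4) (.of_forall fun n => ?_)
    have h := hpsi n
    rw [Nat.floor_natCast] at h
    rw [← h, Real.rpow_one, Real.norm_of_nonneg (Chebyshev.psi_nonneg _),
      Real.norm_of_nonneg n.cast_nonneg]
    exact Chebyshev.psi_le_const_mul_self n.cast_nonneg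

lemma laplace_psi_exp {s : ℂ} (hs : 0 < s.re) :
    ∫ v in Ioi (0 : ℝ),
        ((Chebyshev.psi (Real.exp v) * Real.exp (-v) - 1 : ℝ) : ℂ) * Complex.exp (-(s * v)) =
      LSeries (fun n => (ArithmeticFunction.vonMangoldt n : ℂ)) (s + 1) / (s + 1) - 1 / s := by
  have hs0 : s ≠ 0 := fun h => by simp [h] at hs
  have hs1 : s + 1 ≠ 0 := fun h => by
    have := congrArg Complex.re h
    simp at this
    linarith
  have hE : IntegrableOn (fun v : ℝ => Complex.exp (-s * v)) (Ioi 0) :=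
    integrableOn_exp_mul_complex_Ioi (by simpa using hs) 0
  have hEint : ∫ v in Ioi (0 : ℝ), Complex.exp (-s * v) = 1 / s := by
    rw [integral_exp_mul_complex_Ioi (by simpa using hs)]
    simp
  have hP : IntegrableOn (fun v : ℝ =>
      ((Chebyshev.psi (Real.exp v) * Real.exp (-v) : ℝ) : ℂ) * Complex.exp (-s * v)) (Ioi 0) := by
    have hm := Chebyshev.psi_mono.measurable
    refine hE.bdd_mul (c := Real.log 4 + 4)
      (Measurable.aestronglyMeasurable (by fun_prop)) (ae_of_all _ fun v => ?_)
    rw [Complex.norm_real, Real.norm_of_nonneg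
      (mul_nonneg (Chebyshev.psi_nonneg _) (Real.exp_pos _).le), Real.exp_neg,
      ← div_eq_mul_inv, div_le_iff₀ (Real.exp_pos _)]
    exact Chebyshev.psi_le_const_mul_self (Real.exp_pos _).le
  simp_rw [Complex.ofReal_sub, sub_mul, Complex.ofReal_one, one_mul, ← neg_mul]
  rw [integral_sub hP hE, hEint, LSeries_vonMangoldt_eq_mul_integral_psi (by simpa using hs),
    mul_div_cancel_left₀ _ hs1]
  congr 1
  have := integral_comp_exp_Ioi
    (fun t : ℝ => (Chebyshev.psi t : ℂ) * (t : ℂ) ^ (-(s + 1 + 1))) 0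
  rw [Real.exp_zero] at this
  rw [← this]
  refine setIntegral_congr_fun measurableSet_Ioi fun v _ => ?_
  simp only [Complex.real_smul]
  rw [Complex.cpow_def_of_ne_zero (by exact_mod_cast (Real.exp_pos v).ne'),
    ← Complex.ofReal_log (Real.exp_pos v).le, Real.log_exp]
  push_cast
  rw [mul_left_comm, mul_assoc, ← Complex.exp_add, ← Complex.exp_add]
  congr 2
  ring

theorem tendsto_psi_exp_mul_exp_neg :
    Tendsto (fun v : ℝ => Chebyshev.psi (Real.exp v) * Real.exp (-v)) atTop (𝓝 1) := by
  obtain ⟨H, hHc, hH⟩ := exists_continuousOn_sub_pole_vonMangoldt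
  have hm := Chebyshev.psi_mono.measurable
  have hne : ∀ s : ℂ, 0 ≤ s.re → s + 1 ≠ 0 := fun s hs h => by
    have := congrArg Complex.re h
    simp at this
    linarith
  -- With `H s = L(Λ, s) - 1 / (s - 1)`, the transform `L(Λ, s + 1) / (s + 1) - 1 / s` of `b - 1`
  -- equals `(H (s + 1) - 1) / (s + 1)`, which has no pole at `0`.
  refine tendsto_one_of_laplace_continuousOn (C := Real.log 4 + 4)
    (G := fun s => (H (s + 1) - 1) / (s + 1)) (by fun_prop)
    (fun v => mul_nonneg (Chebyshev.psi_nonneg _) (Real.exp_pos _).le) (fun v => ?_)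
    (fun v hv => ?_) (fun v w hvw => ?_) ?_ (fun s hs => ?_)
  · rw [Real.exp_neg, ← div_eq_mul_inv, div_le_iff₀ (Real.exp_pos _)]
    exact Chebyshev.psi_le_const_mul_self (Real.exp_pos _).le
  · rw [Chebyshev.psi_eq_zero_of_le_one (Real.exp_le_one_iff.2 hv), zero_mul]
  · rw [mul_assoc, ← Real.exp_add, show -w + (w - v) = -v by ring]
    gcongr
  · refine ContinuousOn.div ((hHc.comp (by fun_prop) fun s hs => ?_).sub continuousOn_const)
      (by fun_prop) fun s hs => hne s hs
    simpa using hs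
  · have hs0 : s ≠ 0 := fun h => by simp [h] at hs
    have hs1 := hne s hs.le
    rw [laplace_psi_exp hs, hH _ (by simpa using hs), add_sub_cancel_right]
    field_simp
    ring

/-- The **prime number theorem** in terms of the Chebyshev function. -/
theorem psi_isEquivalent_id : Chebyshev.psi ~[atTop] fun x : ℝ => x := by
  rw [isEquivalent_iff_tendsto_one ((eventually_ne_atTop 0).mono fun x hx => hx)]
  refine (tendsto_psi_exp_mul_exp_neg.comp Real.tendsto_log_atTop).congr' ?_
  filter_upwards [eventually_gt_atTop 0] with x hx
  simp [Real.exp_neg, Real.exp_log hx, div_eq_mul_inv]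

/-! ### Slow decrease, and increments of the Chebyshev function -/

lemma isSlowlyDecreasing_of_tendsto {u : ℝ → ℝ} {l : ℝ} (hu : Tendsto u atTop (𝓝 l)) :
    IsSlowlyDecreasing u := by
  refine ⟨0, tendsto_const_nhds.congr' ?_, le_rfl⟩
  filter_upwards [self_mem_nhdsWithin] with lam hlam
  have hlam0 : (0 : ℝ) < lam := one_pos.trans hlam
  have h := (hu.comp (tendsto_id.const_mul_atTop hlam0)).sub hu
  rw [sub_self] at h
  exact ((continuous_coe_real_ereal.tendsto 0).comp h).liminf_eq.symm

theorem mainTheorem4 :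
    ((Chebyshev.psi ~[atTop] fun x : ℝ => x) ↔
      IsSlowlyDecreasing fun x : ℝ => Chebyshev.psi x / x) ∧
    ((Chebyshev.psi ~[atTop] fun x : ℝ => x) →
      (fun p : ℝ × ℝ => (Chebyshev.psi p.2 - Chebyshev.psi p.1) - (p.2 - p.1))
        =o[(atTop ×ˢ atTop) ⊓ 𝓟 {p : ℝ × ℝ | p.1 ≤ p.2}] fun p : ℝ × ℝ => p.2) := by
  refine ⟨⟨fun h => isSlowlyDecreasing_of_tendsto (l := 1) ?_, fun _ => psi_isEquivalent_id⟩,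
    fun h => ?_⟩
  · exact (isEquivalent_iff_tendsto_one ((eventually_ne_atTop 0).mono fun x hx => hx)).1 h
  · have h2 : (fun p : ℝ × ℝ => Chebyshev.psi p.2 - p.2)
        =o[(atTop ×ˢ atTop) ⊓ 𝓟 {p : ℝ × ℝ | p.1 ≤ p.2}] fun p => p.2 :=
      h.isLittleO.comp_tendsto (tendsto_snd.mono_left inf_le_left)
    have h1 : (fun p : ℝ × ℝ => Chebyshev.psi p.1 - p.1)
        =o[(atTop ×ˢ atTop) ⊓ 𝓟 {p : ℝ × ℝ | p.1 ≤ p.2}] fun p => p.1 :=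
      h.isLittleO.comp_tendsto (tendsto_fst.mono_left inf_le_left)
    have h12 : (fun p : ℝ × ℝ => p.1)
        =O[(atTop ×ˢ atTop) ⊓ 𝓟 {p : ℝ × ℝ | p.1 ≤ p.2}] fun p => p.2 := by
      refine IsBigO.of_bound' ?_
      filter_upwards [inf_le_left (a := (atTop ×ˢ atTop : Filter (ℝ × ℝ)))
        (tendsto_fst.eventually (eventually_ge_atTop 0)), mem_inf_of_right (mem_principal_self _)]
        with p hp hle
      rw [Real.norm_of_nonneg hp, Real.norm_of_nonneg (hp.trans hle)]
      exact hle
    exact (h2.sub (h1.trans_isBigO h12)).congr_left fun p => by ring
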